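/- Let $G$ be a group, $K$ a field and $\lambda : G\times G\to U(K)$ a $2$-cocycle with respect to the trivial action of $G$ on the multiplicative group $U(K)$ of $K$, i.e. $\lambda_{g,h}\lambda_{gh,k}=\lambda_{h,k}\lambda_{g,hk}$ for all $g,h,k\in G$. Let $K_\lambda G$ be the twisted group algebra: the associative unital $K$-algebra with $K$-basis $\{u_g\mid g\in G\}$ and multiplication determined by $u_gu_h=\lambda_{g,h}u_{gh}$. Let $U$ be the group of units of $K_\lambda G$, let $\Delta U$ be its $FC$-center, i.e. the subgroup of all elements of $U$ having only finitely many conjugates in $U$, and let $t(\Delta U)$ be the subgroup of all elements of finite order in $\Delta U$. If $K_\lambda G$ is infinite, then $\Delta U$ is solvable of derived length at most $3$, and $t(\Delta U)$ is nilpotent of class at most $2$. -/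

import Mathlib

/-- A `2`-cocycle of the group `G` with values in the unit group `U(K)`, with respect to the
trivial action of `G`. It is not assumed to be normalized. -/
structure TwoCocycle (G K : Type*) [Group G] [Field K] where
  /-- The values of the cocycle. -/
  toFun : G → G → Kˣ
  /-- The cocycle identity. -/
  cocycle : ∀ g h k : G, toFun g h * toFun (g * h) k = toFun h k * toFun g (h * k)

/-- The twisted group algebra `K_λ G`: the `K`-vector space of finitely supported functions
`G → K`, i.e. of formal finite sums `∑ a_g u_g`, with the multiplication determined by
`u_g * u_h = λ_{g,h} u_{gh}`. -/
def TwistedGroupAlgebra {G K : Type*} [Group G] [Field K] (_c : TwoCocycle G K) : Type _ :=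
  G →₀ K

namespace TwistedGroupAlgebra

variable {G K : Type*} [Group G] [Field K] (c : TwoCocycle G K)

noncomputable instance : AddCommGroup (TwistedGroupAlgebra c) :=
  inferInstanceAs (AddCommGroup (G →₀ K))

noncomputable instance : Module K (TwistedGroupAlgebra c) :=
  inferInstanceAs (Module K (G →₀ K))

/-- The element `a • u_g`. -/
noncomputable def single (g : G) (a : K) : TwistedGroupAlgebra c :=
  Finsupp.single g a

/-- `(∑ a_g u_g) * (∑ b_h u_h) = ∑ a_g b_h λ_{g,h} u_{gh}`. -/
noncomputable instance : Mul (TwistedGroupAlgebra c) where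
  mul x y := Finsupp.sum x fun g a => Finsupp.sum y fun h b =>
    single c (g * h) (a * b * (c.toFun g h : K))

/-- The identity element is `λ_{1,1}⁻¹ • u_1`. -/
noncomputable instance : One (TwistedGroupAlgebra c) where
  one := single c 1 ((c.toFun 1 1)⁻¹ : Kˣ)

theorem single_zero (g : G) : single c g 0 = 0 := Finsupp.single_zero g

theorem single_add (g : G) (a b : K) : single c g (a + b) = single c g a + single c g b :=
  Finsupp.single_add g a b

theorem smul_single (r : K) (g : G) (a : K) : r • single c g a = single c g (r * a) :=
  Finsupp.smul_single r g a

theorem mul_def (x y : TwistedGroupAlgebra c) :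
    x * y = Finsupp.sum x fun g a => Finsupp.sum y fun h b =>
      single c (g * h) (a * b * (c.toFun g h : K)) := rfl

theorem one_def : (1 : TwistedGroupAlgebra c) = single c 1 ((c.toFun 1 1)⁻¹ : Kˣ) := rfl

theorem induction_on {p : TwistedGroupAlgebra c → Prop} (x : TwistedGroupAlgebra c)
    (h0 : p 0) (hadd : ∀ x y, p x → p y → p (x + y)) (hs : ∀ g a, p (single c g a)) : p x :=
  Finsupp.induction_linear x h0 hadd hs

theorem zero_mul' (x : TwistedGroupAlgebra c) : 0 * x = 0 := Finsupp.sum_zero_index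

theorem mul_zero' (x : TwistedGroupAlgebra c) : x * 0 = 0 := by
  rw [mul_def]
  exact Finset.sum_eq_zero fun _ _ => Finsupp.sum_zero_index

theorem add_mul' (x y z : TwistedGroupAlgebra c) : (x + y) * z = x * z + y * z := by
  classical
  refine Finsupp.sum_add_index' (fun g => ?_) (fun g a b => ?_)
  · simp only [zero_mul, single_zero]
    exact Finset.sum_const_zero
  · simp only [add_mul, single_add]
    exact Finsupp.sum_add

theorem mul_add' (x y z : TwistedGroupAlgebra c) : x * (y + z) = x * y + x * z := by
  classical
  refine Eq.trans (Finsupp.sum_congr fun g _ => ?_) Finsupp.sum_add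
  refine Finsupp.sum_add_index' (fun h => ?_) (fun h a b => ?_)
  · simp [single_zero]
  · simp only [mul_add, add_mul, single_add]

theorem single_mul_single (g h : G) (a b : K) :
    single c g a * single c h b = single c (g * h) (a * b * (c.toFun g h : K)) := by
  rw [mul_def]
  refine (Finsupp.sum_single_index ?_).trans (Finsupp.sum_single_index ?_)
  · simp only [zero_mul, single_zero]
    exact Finset.sum_const_zero
  · simp [single_zero]

theorem toFun_one_left (g : G) : c.toFun 1 g = c.toFun 1 1 := by
  have h := c.cocycle 1 1 g
  simp only [one_mul] at h
  exact (mul_right_cancel h).symm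

theorem toFun_one_right (g : G) : c.toFun g 1 = c.toFun 1 1 := by
  have h := c.cocycle g 1 1
  simp only [mul_one] at h
  exact mul_right_cancel h

theorem mul_assoc' (x y z : TwistedGroupAlgebra c) : x * y * z = x * (y * z) := by
  induction x using induction_on with
  | h0 => simp only [zero_mul']
  | hadd x₁ x₂ h₁ h₂ => simp only [add_mul', h₁, h₂]
  | hs g a =>
    induction y using induction_on with
    | h0 => simp only [zero_mul', mul_zero']
    | hadd y₁ y₂ h₁ h₂ => simp only [add_mul', mul_add', h₁, h₂]
    | hs h b =>
      induction z using induction_on with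
      | h0 => simp only [mul_zero']
      | hadd z₁ z₂ h₁ h₂ => simp only [mul_add', h₁, h₂]
      | hs k d =>
        simp only [single_mul_single, mul_assoc g h k]
        have e := congrArg (Units.val) (c.cocycle g h k)
        simp only [Units.val_mul] at e
        congr 1
        linear_combination a * b * d * e

theorem one_mul' (x : TwistedGroupAlgebra c) : 1 * x = x := by
  induction x using induction_on with
  | h0 => exact mul_zero' c 1
  | hadd x₁ x₂ h₁ h₂ => rw [mul_add', h₁, h₂]
  | hs g a =>
    rw [one_def, single_mul_single, toFun_one_left c g, one_mul, mul_right_comm, Units.inv_mul,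
      one_mul]

theorem mul_one' (x : TwistedGroupAlgebra c) : x * 1 = x := by
  induction x using induction_on with
  | h0 => exact zero_mul' c 1
  | hadd x₁ x₂ h₁ h₂ => rw [add_mul', h₁, h₂]
  | hs g a =>
    rw [one_def, single_mul_single, toFun_one_right c g, mul_one, mul_assoc, Units.inv_mul,
      mul_one]

noncomputable instance : Ring (TwistedGroupAlgebra c) where
  left_distrib := mul_add' c
  right_distrib := add_mul' c
  zero_mul := zero_mul' c
  mul_zero := mul_zero' c
  mul_assoc := mul_assoc' c
  one_mul := one_mul' c
  mul_one := mul_one' c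
  neg_add_cancel := neg_add_cancel
  zsmul := fun n x => n • x
  zsmul_zero' := SubNegMonoid.zsmul_zero'
  zsmul_succ' := SubNegMonoid.zsmul_succ'
  zsmul_neg' := SubNegMonoid.zsmul_neg'
  sub_eq_add_neg := sub_eq_add_neg

theorem smul_mul' (r : K) (x y : TwistedGroupAlgebra c) : r • x * y = r • (x * y) := by
  induction x using induction_on with
  | h0 => simp only [smul_zero, zero_mul]
  | hadd x₁ x₂ h₁ h₂ => simp only [smul_add, add_mul, h₁, h₂]
  | hs g a =>
    induction y using induction_on with
    | h0 => simp only [mul_zero, smul_zero]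
    | hadd y₁ y₂ h₁ h₂ => simp only [mul_add, smul_add, h₁, h₂]
    | hs h b => simp only [smul_single, single_mul_single, mul_assoc]

theorem mul_smul' (r : K) (x y : TwistedGroupAlgebra c) : x * r • y = r • (x * y) := by
  induction x using induction_on with
  | h0 => simp only [smul_zero, zero_mul]
  | hadd x₁ x₂ h₁ h₂ => simp only [smul_add, add_mul, h₁, h₂]
  | hs g a =>
    induction y using induction_on with
    | h0 => simp only [mul_zero, smul_zero]
    | hadd y₁ y₂ h₁ h₂ => simp only [mul_add, smul_add, h₁, h₂]
    | hs h b => simp only [smul_single, single_mul_single, mul_assoc, mul_left_comm a r]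

noncomputable instance : Algebra K (TwistedGroupAlgebra c) :=
  Algebra.ofModule (smul_mul' c) (mul_smul' c)

/-- The `K`-basis `{u_g | g ∈ G}` of `K_λ G`. -/
noncomputable def u : Module.Basis G K (TwistedGroupAlgebra c) :=
  Module.Basis.ofRepr (LinearEquiv.refl K (G →₀ K))

theorem u_apply (g : G) : u c g = single c g 1 := rfl

/-- The defining relation `u_g * u_h = λ_{g,h} u_{gh}`. -/
theorem u_mul_u (g h : G) : u c g * u c h = (c.toFun g h : K) • u c (g * h) := by
  simp only [u_apply, single_mul_single, smul_single, one_mul, mul_one]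

end TwistedGroupAlgebra

/-- The `FC`-center of a group: the subgroup of all elements with only finitely many
conjugates. -/
def fcCenter (Γ : Type*) [Group Γ] : Subgroup Γ where
  carrier := {x | (conjugatesOf x).Finite}
  one_mem' := by
    refine (Set.finite_singleton (1 : Γ)).subset fun y hy => ?_
    obtain ⟨g, rfl⟩ := isConj_iff.1 hy
    simp
  mul_mem' := by
    intro x y hx hy
    refine (Set.Finite.image2 (· * ·) hx hy).subset fun z hz => ?_
    obtain ⟨g, rfl⟩ := isConj_iff.1 hz
    exact ⟨g * x * g⁻¹, isConj_iff.2 ⟨g, rfl⟩, g * y * g⁻¹, isConj_iff.2 ⟨g, rfl⟩, by group⟩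
  inv_mem' := by
    intro x hx
    refine (Set.Finite.image (·⁻¹) hx).subset fun z hz => ?_
    obtain ⟨g, rfl⟩ := isConj_iff.1 hz
    exact ⟨g * x * g⁻¹, isConj_iff.2 ⟨g, rfl⟩, by group⟩

theorem finiteIndex_centralizer_of_finite_conjugatesOf {Γ : Type*} [Group Γ] {x : Γ}
    (hx : (conjugatesOf x).Finite) : (Subgroup.centralizer {x}).FiniteIndex := by
  have := hx.to_subtype
  have hinj : Function.Injective (fun q : Γ ⧸ Subgroup.centralizer {x} =>
      (Quotient.liftOn' q (fun g => (⟨g * x * g⁻¹, isConj_iff.2 ⟨g, rfl⟩⟩ : conjugatesOf x))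
        (by
          intro a b hab
          have h := Subgroup.mem_centralizer_singleton_iff.1 (QuotientGroup.leftRel_apply.1 hab)
          have h' : b * x * b⁻¹ = a * ((a⁻¹ * b) * x) * b⁻¹ := by group
          refine Subtype.ext ?_
          change a * x * a⁻¹ = b * x * b⁻¹
          rw [h', h]
          group))) := by
    intro p q
    induction p using QuotientGroup.induction_on
    induction q using QuotientGroup.induction_on
    rename_i a b
    intro h
    have h : a * x * a⁻¹ = b * x * b⁻¹ := congrArg Subtype.val h
    refine QuotientGroup.eq.2 (Subgroup.mem_centralizer_singleton_iff.2 ?_)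
    calc a⁻¹ * b * x = a⁻¹ * (b * x * b⁻¹) * b := by group
      _ = a⁻¹ * (a * x * a⁻¹) * b := by rw [h]
      _ = x * (a⁻¹ * b) := by group
  have := Finite.of_injective _ hinj
  exact Subgroup.finiteIndex_of_finite_quotient

/-- A product of two elements of finite order with finitely many conjugates has finite order. -/
theorem isOfFinOrder_mul_of_finite_conjugatesOf {Γ : Type*} [Group Γ] {x y : Γ}
    (hx : (conjugatesOf x).Finite) (hy : (conjugatesOf y).Finite)
    (ox : IsOfFinOrder x) (oy : IsOfFinOrder y) : IsOfFinOrder (x * y) := by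
  have := finiteIndex_centralizer_of_finite_conjugatesOf hx
  have := finiteIndex_centralizer_of_finite_conjugatesOf hy
  let H := Subgroup.closure {x, y}
  let C := Subgroup.centralizer {x} ⊓ Subgroup.centralizer {y}
  have hC : (C.subgroupOf H).FiniteIndex := inferInstance
  have hcomm : ∀ z ∈ C, ∀ h ∈ H, z * h = h * z := by
    intro z hz h hh
    have hle : H ≤ Subgroup.centralizer {z} := by
      refine (Subgroup.closure_le _).2 ?_
      rintro w (rfl | rfl)
      · exact Subgroup.mem_centralizer_singleton_iff.2
          (Subgroup.mem_centralizer_singleton_iff.1 hz.1).symm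
      · exact Subgroup.mem_centralizer_singleton_iff.2
          (Subgroup.mem_centralizer_singleton_iff.1 hz.2).symm
    exact (Subgroup.mem_centralizer_singleton_iff.1 (hle hh)).symm
  have hle : C.subgroupOf H ≤ Subgroup.center H := by
    intro z hz
    refine Subgroup.mem_center_iff.2 fun h => Subtype.ext ?_
    exact (hcomm z hz h h.2).symm
  have hZ : (Subgroup.center H).FiniteIndex := Subgroup.finiteIndex_of_le hle
  have hfin : Finite (commutatorSet H) := by
    have : Finite (H ⧸ Subgroup.center H) := inferInstance
    refine Set.Finite.subset (Set.finite_range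
      fun p : (H ⧸ Subgroup.center H) × (H ⧸ Subgroup.center H) =>
        p.1.out * p.2.out * p.1.out⁻¹ * p.2.out⁻¹) ?_
    rintro _ ⟨a, b, rfl⟩
    refine ⟨(a, b), ?_⟩
    obtain ⟨⟨z, hzc⟩, hz⟩ := QuotientGroup.mk_out_eq_mul (Subgroup.center H) a
    obtain ⟨⟨w, hwc⟩, hw⟩ := QuotientGroup.mk_out_eq_mul (Subgroup.center H) b
    change (a : H ⧸ Subgroup.center H).out * (b : H ⧸ Subgroup.center H).out *
      (a : H ⧸ Subgroup.center H).out⁻¹ * (b : H ⧸ Subgroup.center H).out⁻¹ =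
      a * b * a⁻¹ * b⁻¹
    rw [hz, hw]
    have hz' := Subgroup.mem_center_iff.1 hzc
    have hw' := Subgroup.mem_center_iff.1 hwc
    rw [mul_inv_rev, mul_inv_rev]
    change a * z * (b * w) * (z⁻¹ * a⁻¹) * (w⁻¹ * b⁻¹) = _
    calc a * z * (b * w) * (z⁻¹ * a⁻¹) * (w⁻¹ * b⁻¹)
        = a * (z * (b * w * z⁻¹)) * a⁻¹ * (w⁻¹ * b⁻¹) := by group
      _ = a * (b * w * z⁻¹ * z) * a⁻¹ * (w⁻¹ * b⁻¹) := by rw [hz']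
      _ = a * b * (w * a⁻¹) * w⁻¹ * b⁻¹ := by group
      _ = a * b * (a⁻¹ * w) * w⁻¹ * b⁻¹ := by rw [← hw' a⁻¹]
      _ = a * b * a⁻¹ * b⁻¹ := by group
  have hfin' : Finite (commutator H) := inferInstance
  let x' : H := ⟨x, Subgroup.subset_closure (by simp)⟩
  let y' : H := ⟨y, Subgroup.subset_closure (by simp)⟩
  have ox' : IsOfFinOrder x' := Submonoid.isOfFinOrder_coe.1 ox
  have oy' : IsOfFinOrder y' := Submonoid.isOfFinOrder_coe.1 oy
  have hab : IsOfFinOrder (Abelianization.of (x' * y')) := by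
    rw [map_mul]
    exact (Abelianization.of.isOfFinOrder ox').mul (Abelianization.of.isOfFinOrder oy')
  obtain ⟨n, hn, hpow⟩ := isOfFinOrder_iff_pow_eq_one.1 hab
  have hmem : (x' * y') ^ n ∈ commutator H := by
    rw [← Abelianization.ker_of, MonoidHom.mem_ker, map_pow, hpow]
  have ho : IsOfFinOrder ((x' * y') ^ n) :=
    Submonoid.isOfFinOrder_coe.2 (isOfFinOrder_of_finite (⟨_, hmem⟩ : commutator H))
  have ho' : IsOfFinOrder (x' * y') := (isOfFinOrder_pow.1 ho).resolve_right hn.ne'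
  exact H.subtype.isOfFinOrder ho'

/-- The torsion subgroup of the `FC`-center: the subgroup of all its elements of finite order. -/
def fcTorsion (Γ : Type*) [Group Γ] : Subgroup (fcCenter Γ) where
  carrier := {x | IsOfFinOrder x}
  one_mem' := IsOfFinOrder.one
  mul_mem' := by
    intro x y hx hy
    exact Submonoid.isOfFinOrder_coe.1 (isOfFinOrder_mul_of_finite_conjugatesOf x.2 y.2
      (Submonoid.isOfFinOrder_coe.2 hx) (Submonoid.isOfFinOrder_coe.2 hy))
  inv_mem' := fun hx => hx.inv

/-! Everything rests on one fact: for torsion units `x`, `y` in the FC-center, `⁅x, y⁆` commutes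
with the whole FC-center. Commutators of FC-elements are torsion, so both bounds follow formally.

The engine is pigeonhole: for infinitely many units `v`, a fixed FC-element `z` has the same
conjugate `z'`. Applied to an affine family of units, this forces `z = z'`. If `K` is infinite, the
family `a - x` with `a` in `K` and `x` torsion shows that `x` commutes with `z`. If `K` is finite,
then `G` is infinite, and the family `1 + b w`, with `b` nilpotent and `w` running over modified
basis units, shows that `b` commutes with `z`. For torsion `x`, `y` the algebra `B` they generate is
finite; its nilpotents are then central, so `B` modulo its radical is reduced semisimple, hence
commutative by Wedderburn. Thus `xy - yx` is nilpotent, and `⁅x, y⁆` is 1 plus a nilpotent of `B`.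
-/

/-! ### Finite rings with central nilpotents -/

/-- A finite reduced semisimple ring is commutative. -/
theorem commute_of_finite_of_isSemisimpleRing_of_isReduced {R : Type*} [Ring R] [Finite R]
    [IsSemisimpleRing R] [IsReduced R] (x y : R) : Commute x y := by
  obtain ⟨n, D, d, _, _, ⟨e⟩⟩ := IsSemisimpleRing.exists_ringEquiv_pi_matrix_divisionRing R
  have hred (i : Fin n) (M : Matrix (Fin (d i)) (Fin (d i)) (D i)) (hM : M * M = 0) : M = 0 := by
    have h : IsNilpotent (e.symm (Pi.single i M)) := by
      refine ⟨2, ?_⟩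
      rw [pow_two, ← map_mul, ← Pi.single_mul, hM, Pi.single_zero, map_zero]
    simpa using h.eq_zero
  -- An off-diagonal matrix unit squares to zero, so every block has size at most 1.
  have hsub (i : Fin n) : Subsingleton (Fin (d i)) := by
    refine ⟨fun a b => by_contra fun hab => ?_⟩
    have h := hred i (Matrix.single a b 1)
      (Matrix.single_mul_single_of_ne _ _ _ _ (Ne.symm hab) _)
    simpa using congrFun (congrFun h a) b
  have hfin (i : Fin n) : Finite (D i) := by
    refine Finite.of_injective (fun t => e.symm (Pi.single i (Matrix.scalar (Fin (d i)) t))) ?_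
    intro s t hst
    exact Matrix.scalar_inj.1 (Pi.single_injective i (e.symm.injective hst))
  refine e.injective (funext fun i => ?_)
  rw [map_mul, map_mul]
  ext a b
  -- Wedderburn's little theorem: finite division rings are fields.
  have hc := (Finite.isDomain_to_isField (D i)).mul_comm
  have hb : b = a := Subsingleton.elim _ _
  subst hb
  simp only [Pi.mul_apply, Matrix.mul_apply]
  refine Finset.sum_congr rfl fun j _ => ?_
  have hj : j = b := Subsingleton.elim _ _
  rw [hj, hc]

/-- In a finite ring with central nilpotent elements all additive commutators are nilpotent. -/
theorem isNilpotent_commutator_of_finite_of_nilpotent_central {R : Type*} [Ring R] [Finite R]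
    (h : ∀ b : R, IsNilpotent b → ∀ a, Commute b a) (x y : R) : IsNilpotent (x * y - y * x) := by
  -- The radical is nilpotent; conversely, for a central nilpotent `b` each `y * b` is nilpotent, so
  -- `1 + y * b` is a unit.
  have hJ : ∀ b : R, b ∈ Ring.jacobson R ↔ IsNilpotent b := by
    obtain ⟨k, hk⟩ := IsSemiprimaryRing.isNilpotent (R := R)
    intro b
    refine ⟨fun hb => ⟨k, ?_⟩, fun hb => ?_⟩
    · have := Ideal.pow_mem_pow hb k
      rwa [hk] at this
    · rw [← Ideal.jacobson_bot, Ideal.mem_jacobson_iff]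
      intro y
      obtain ⟨v, hv⟩ := ((h b hb y).symm.isNilpotent_mul_left hb).isUnit_one_add
      refine ⟨↑v⁻¹, ?_⟩
      have e : (↑v⁻¹ : R) * y * b + ↑v⁻¹ - 1 = ↑v⁻¹ * (1 + y * b) - 1 := by
        rw [add_comm (1 : R), mul_add, mul_one, mul_assoc]
      rw [e, ← hv, Units.inv_mul, sub_self]
      exact Ideal.zero_mem _
  have hred : IsReduced (R ⧸ Ring.jacobson R) := by
    refine ⟨fun q => ?_⟩
    obtain ⟨b, rfl⟩ := Ideal.Quotient.mk_surjective q
    rintro ⟨k, hk⟩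
    rw [← map_pow, Ideal.Quotient.eq_zero_iff_mem, hJ] at hk
    obtain ⟨l, hl⟩ := hk
    rw [Ideal.Quotient.eq_zero_iff_mem, hJ]
    exact ⟨k * l, by rw [pow_mul, hl]⟩
  have : Finite (R ⧸ Ring.jacobson R) := Finite.of_surjective _ Ideal.Quotient.mk_surjective
  rw [← hJ, ← Ideal.Quotient.eq_zero_iff_mem, map_sub, map_mul, map_mul, sub_eq_zero]
  exact commute_of_finite_of_isSemisimpleRing_of_isReduced _ _

/-- Pigeonhole on the finite conjugacy class of `z`; stated without inverses so that it becomes an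
additive identity in the algebra. -/
theorem exists_infinite_setOf_conj_eq {Γ ι : Type*} [Group Γ] [Infinite ι] {z : Γ}
    (hz : (conjugatesOf z).Finite) (v : ι → Γ) :
    ∃ z', {i | v i * z = z' * v i}.Infinite := by
  have := hz.to_subtype
  obtain ⟨z', hz'⟩ := Finite.exists_infinite_fiber
    (fun i => (⟨v i * z * (v i)⁻¹, isConj_iff.2 ⟨v i, rfl⟩⟩ : conjugatesOf z))
  refine ⟨z', (Set.infinite_coe_iff.1 hz').mono fun i hi => ?_⟩
  have h : v i * z * (v i)⁻¹ = z' := congrArg Subtype.val hi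
  rw [Set.mem_ofPred_eq, ← h, inv_mul_cancel_right]

/-! ### Nilpotent elements when `G` is infinite -/

namespace TwistedGroupAlgebra

variable {G K : Type*} [Group G] [Field K] {c : TwoCocycle G K}

variable (c) in
theorem isUnit_u (g : G) : IsUnit (u c g) := by
  refine isUnit_iff_exists_and_exists.2
    ⟨⟨single c g⁻¹ (((c.toFun g g⁻¹)⁻¹ * (c.toFun 1 1)⁻¹ : Kˣ) : K), ?_⟩,
      ⟨single c g⁻¹ (((c.toFun g⁻¹ g)⁻¹ * (c.toFun 1 1)⁻¹ : Kˣ) : K), ?_⟩⟩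
  · rw [u_apply, single_mul_single, one_def, mul_inv_cancel, one_mul, ← Units.val_mul,
      mul_right_comm, inv_mul_cancel, one_mul]
  · rw [u_apply, single_mul_single, one_def, inv_mul_cancel, mul_one, ← Units.val_mul,
      mul_right_comm, inv_mul_cancel, one_mul]

theorem repr_mul_u (d : TwistedGroupAlgebra c) (h g : G) :
    (u c).repr (d * u c g) (h * g) = (u c).repr d h * c.toFun h g := by
  have hs (k : G) (a : K) : single c k a = a • u c k := by
    rw [u_apply, smul_single, mul_one]
  induction d using induction_on with
  | h0 => simp
  | hadd x y hx hy => rw [add_mul, map_add, map_add, Finsupp.add_apply, Finsupp.add_apply, hx, hy,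
      add_mul]
  | hs k a =>
    classical
    rw [hs, smul_mul_assoc, u_mul_u, map_smul, map_smul, map_smul, Module.Basis.repr_self,
      Module.Basis.repr_self]
    by_cases hk : k = h
    · subst hk
      simp
    · simp [hk]

/-- If infinitely many of the products `d * u_g` coincide, then `d = 0`. -/
theorem eq_zero_of_infinite_mul_u_eq {d e : TwistedGroupAlgebra c} {T : Set G} (hT : T.Infinite)
    (h : ∀ g ∈ T, d * u c g = e) : d = 0 := by
  by_contra hd
  have hd' : (u c).repr d ≠ 0 := by simpa using hd
  obtain ⟨k, hk⟩ := Finsupp.ne_iff.1 hd'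
  -- A nonzero coefficient of `d` at `k` puts `k * g` in the finite support of `e` for every `g` in
  -- `T`.
  refine hT ((((u c).repr e).hasFiniteSupport.preimage
    (f := fun g => k * g) (mul_right_injective k).injOn).subset fun g hg => ?_)
  rw [Set.mem_preimage, Function.mem_support, ← h g hg, repr_mul_u]
  exact mul_ne_zero hk (Units.ne_zero _)

/-- If `G` is infinite, a nilpotent element whose centralizer in the unit group has finite index
commutes with the `FC`-center of the unit group. -/
theorem commute_of_isNilpotent [Infinite G] {b : TwistedGroupAlgebra c} (hb : IsNilpotent b)
    (C : Subgroup (TwistedGroupAlgebra c)ˣ) [C.FiniteIndex]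
    (hC : ∀ v ∈ C, Commute (v : TwistedGroupAlgebra c) b) {z : (TwistedGroupAlgebra c)ˣ}
    (hz : (conjugatesOf z).Finite) : Commute (z : TwistedGroupAlgebra c) b := by
  have := finiteIndex_centralizer_of_finite_conjugatesOf hz
  let C' := C ⊓ Subgroup.centralizer {z}
  let m (g : G) : (TwistedGroupAlgebra c)ˣ := (isUnit_u c g).unit
  -- Infinitely many `u_g` share a coset of `C'`; dividing by one of them gives elements `w g` of
  -- `C'`, which commute with both `b` and `z`.
  obtain ⟨q, hq⟩ := Finite.exists_infinite_fiber
    (fun g => (m g : (TwistedGroupAlgebra c)ˣ ⧸ C'))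
  obtain ⟨g₀, hg₀⟩ := (Set.infinite_coe_iff.1 hq).nonempty
  set S : Set G := (fun g => (m g : (TwistedGroupAlgebra c)ˣ ⧸ C')) ⁻¹' {q}
  let w (g : S) : (TwistedGroupAlgebra c)ˣ := (m g₀)⁻¹ * m g
  have hw (g : S) : w g ∈ C' := QuotientGroup.eq.1 (hg₀.trans g.2.symm)
  have hwb (g : S) : Commute (w g : TwistedGroupAlgebra c) b := hC _ (hw g).1
  have hwz (g : S) : w g * z = z * w g := Subgroup.mem_centralizer_singleton_iff.1 (hw g).2
  have hu (g : S) : IsUnit (1 + b * w g) :=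
    ((hwb g).symm.isNilpotent_mul_right hb).isUnit_one_add
  obtain ⟨z', hz'⟩ := exists_infinite_setOf_conj_eq hz fun g => (hu g).unit
  -- Expanding `(1 + b w) z = z' (1 + b w)` with `w z = z w` gives `(z' b - b z) w = z - z'`, whose
  -- right side is independent of `g`.
  have key (g : S) (hg : g ∈ {g : S | (hu g).unit * z = z' * (hu g).unit}) :
      ((z' * b - b * z : TwistedGroupAlgebra c) * ↑(m g₀)⁻¹) * u c g = z - z' := by
    have h1 : (1 + b * w g) * (z : TwistedGroupAlgebra c) = z' * (1 + b * w g) :=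
      congrArg Units.val hg
    have h2 : (w g : TwistedGroupAlgebra c) * z = z * w g := congrArg Units.val (hwz g)
    have h3 : (↑(m g₀)⁻¹ : TwistedGroupAlgebra c) * u c g = w g := rfl
    rw [mul_assoc, h3, sub_mul, mul_assoc b, ← h2]
    rw [add_mul, mul_add, one_mul, mul_one, mul_assoc] at h1
    rw [mul_assoc, sub_eq_sub_iff_add_eq_add, add_comm, ← h1]
  have hd : (z' * b - b * z : TwistedGroupAlgebra c) * ↑(m g₀)⁻¹ = 0 := by
    refine eq_zero_of_infinite_mul_u_eq (e := z - z')
      (hz'.image (f := Subtype.val) Subtype.val_injective.injOn) ?_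
    rintro _ ⟨g, hg, rfl⟩
    exact key g hg
  obtain ⟨g, hg⟩ := hz'.nonempty
  have he := key g hg
  rw [hd, zero_mul, eq_comm, sub_eq_zero] at he
  rw [Units.mul_left_eq_zero, sub_eq_zero, ← he] at hd
  exact hd

end TwistedGroupAlgebra

/-! ### Torsion units over an infinite field -/

/-- Over an infinite field, a unit of finite order commutes with the `FC`-center of the unit
group. -/
theorem commute_of_isOfFinOrder_of_infinite {K A : Type*} [Field K] [Infinite K] [Ring A]
    [Algebra K A] {x z : Aˣ} (hx : IsOfFinOrder x) (hz : (conjugatesOf z).Finite) :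
    Commute z x := by
  obtain ⟨n, hn, hxn⟩ := isOfFinOrder_iff_pow_eq_one.1 hx
  let S : Set K := {a | a ^ n ≠ 1}
  have hS : S.Infinite := by
    refine Set.Finite.infinite_compl (s := {a : K | a ^ n = 1}) ?_
    refine ((Polynomial.nthRootsFinset n (1 : K)).finite_toSet).subset fun a ha => ?_
    exact (Polynomial.mem_nthRootsFinset hn _).2 ha
  have := hS.to_subtype
  -- `a - x` divides `a ^ n - x ^ n = a ^ n - 1`, a nonzero scalar.
  have hu (a : S) : IsUnit (algebraMap K A a - x) := by
    have hc : Commute (algebraMap K A a) (x : A) := Algebra.commutes _ _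
    have h1 : IsUnit (algebraMap K A a ^ n - (x : A) ^ n) := by
      rw [← Units.val_pow_eq_pow_val, hxn, Units.val_one, ← map_pow, ← map_one (algebraMap K A),
        ← map_sub]
      exact (IsUnit.mk0 _ (sub_ne_zero.2 a.2)).map _
    have hcg : Commute (algebraMap K A a - (x : A)) (∑ i ∈ Finset.range n,
        algebraMap K A a ^ i * (x : A) ^ (n - 1 - i)) := by
      refine Commute.sum_right _ _ _ fun i _ => ?_
      refine Commute.sub_left ?_ ?_
      · exact Algebra.commutes _ _
      · exact Commute.mul_right (hc.symm.pow_right i)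
          ((Commute.refl _).pow_right _)
    rw [← hc.mul_geom_sum₂] at h1
    exact (hcg.isUnit_mul_iff.1 h1).1
  obtain ⟨z', hz'⟩ := exists_infinite_setOf_conj_eq hz fun a => (hu a).unit
  have key (a : S) (ha : a ∈ {a : S | (hu a).unit * z = z' * (hu a).unit}) :
      (a : K) • ((z : A) - z') = x * z - z' * x := by
    have h1 : (algebraMap K A a - x) * (z : A) = z' * (algebraMap K A a - x) :=
      congrArg Units.val ha
    rw [sub_mul, mul_sub, ← Algebra.commutes, ← Algebra.smul_def, ← Algebra.smul_def] at h1
    rw [smul_sub, sub_eq_sub_iff_add_eq_add, sub_eq_sub_iff_add_eq_add.1 h1, add_comm]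
  -- Two distinct scalars with the same value of `a • (z - z')` force `z = z'`.
  obtain ⟨a, ha, a', ha', hne⟩ := hz'.nontrivial
  have h0 : ((a : K) - a') • ((z : A) - z') = 0 := by
    rw [sub_smul, key a ha, key a' ha', sub_self]
  have hzz : (z : A) - z' = 0 :=
    (smul_eq_zero_iff_right (sub_ne_zero.2 fun h => hne (Subtype.ext h))).1 h0
  have h1 := key a ha
  rw [hzz, smul_zero, eq_comm, sub_eq_zero, ← sub_eq_zero.1 hzz] at h1
  exact Units.ext h1.symm

/-! ### Subgroups generated by two FC-elements -/

open scoped commutatorElement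

theorem finiteIndex_center_closure_pair {Γ : Type*} [Group Γ] {x y : Γ}
    (hx : (conjugatesOf x).Finite) (hy : (conjugatesOf y).Finite) :
    (Subgroup.center (Subgroup.closure {x, y})).FiniteIndex := by
  have := finiteIndex_centralizer_of_finite_conjugatesOf hx
  have := finiteIndex_centralizer_of_finite_conjugatesOf hy
  have hle : (Subgroup.centralizer {x} ⊓ Subgroup.centralizer {y}).subgroupOf
      (Subgroup.closure {x, y}) ≤ Subgroup.center (Subgroup.closure {x, y}) := by
    intro z hz
    refine Subgroup.mem_center_iff.2 fun h => Subtype.ext ?_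
    have hc : Subgroup.closure {x, y} ≤ Subgroup.centralizer {(z : Γ)} := by
      refine (Subgroup.closure_le _).2 ?_
      rintro w (rfl | rfl)
      · exact Subgroup.mem_centralizer_singleton_iff.2
          (Subgroup.mem_centralizer_singleton_iff.1 hz.1).symm
      · exact Subgroup.mem_centralizer_singleton_iff.2
          (Subgroup.mem_centralizer_singleton_iff.1 hz.2).symm
    exact Subgroup.mem_centralizer_singleton_iff.1 (hc h.2)
  exact Subgroup.finiteIndex_of_le hle

/-- The transfer into a center of finite index is the power map by that index; its target is
abelian, so it kills commutators. -/
theorem isOfFinOrder_commutatorElement_of_finite_conjugatesOf {Γ : Type*} [Group Γ] {x y : Γ}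
    (hx : (conjugatesOf x).Finite) (hy : (conjugatesOf y).Finite) : IsOfFinOrder ⁅x, y⁆ := by
  have := finiteIndex_center_closure_pair hx hy
  let x' : Subgroup.closure {x, y} := ⟨x, Subgroup.subset_closure (by simp)⟩
  let y' : Subgroup.closure {x, y} := ⟨y, Subgroup.subset_closure (by simp)⟩
  have h : MonoidHom.transferCenterPow (Subgroup.closure {x, y}) ⁅x', y'⁆ = 1 := by
    rw [map_commutatorElement, commutatorElement_eq_one_iff_mul_comm]
    exact Subtype.ext (Subgroup.mem_center_iff.1 (SetLike.coe_mem _) _).symm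
  have h' : ⁅x', y'⁆ ^ (Subgroup.center (Subgroup.closure {x, y})).index = 1 := by
    rw [← MonoidHom.transferCenterPow_apply, h, OneMemClass.coe_one]
  exact (Subgroup.closure {x, y}).subtype.isOfFinOrder
    (isOfFinOrder_iff_pow_eq_one.2 ⟨_, Nat.pos_of_ne_zero Subgroup.FiniteIndex.index_ne_zero, h'⟩)

theorem mem_fcTorsion_iff {Γ : Type*} [Group Γ] {x : fcCenter Γ} :
    x ∈ fcTorsion Γ ↔ IsOfFinOrder (x : Γ) :=
  (show x ∈ fcTorsion Γ ↔ IsOfFinOrder x from Iff.rfl).trans Submonoid.isOfFinOrder_coe.symm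

open scoped IsMulCommutative in
/-- Two elements of finite order with finitely many conjugates generate a finite subgroup. -/
theorem finite_closure_pair_of_finite_conjugatesOf {Γ : Type*} [Group Γ] {x y : Γ}
    (hx : (conjugatesOf x).Finite) (hy : (conjugatesOf y).Finite)
    (ox : IsOfFinOrder x) (oy : IsOfFinOrder y) : Finite (Subgroup.closure {x, y}) := by
  have := finiteIndex_center_closure_pair hx hy
  have htor : ∀ h ∈ Subgroup.closure {x, y}, IsOfFinOrder h := by
    have hle : Subgroup.closure {x, y} ≤ (fcTorsion Γ).map (fcCenter Γ).subtype := by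
      refine (Subgroup.closure_le _).2 ?_
      rintro w (rfl | rfl)
      · exact ⟨⟨w, hx⟩, mem_fcTorsion_iff.2 ox, rfl⟩
      · exact ⟨⟨w, hy⟩, mem_fcTorsion_iff.2 oy, rfl⟩
    intro h hh
    obtain ⟨k, hk, rfl⟩ := hle hh
    exact mem_fcTorsion_iff.1 hk
  have hFG : Group.FG (Subgroup.closure {x, y}) := Group.closure_finite_fg {x, y}
  -- A finite-index subgroup of a finitely generated group is finitely generated; being abelian and
  -- torsion, it is finite.
  have hZ : Finite (Subgroup.center (Subgroup.closure {x, y})) :=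
    CommGroup.finite_of_fg_isMulTorsion _ fun z =>
      Submonoid.isOfFinOrder_coe.1 (Submonoid.isOfFinOrder_coe.1 (htor _ z.1.2))
  exact Finite.of_subgroup_quotient (Subgroup.center (Subgroup.closure {x, y}))

theorem commute_of_mem_closure_pair {A : Type*} [Ring A] {a : A} {x y : Aˣ}
    (hx : Commute a x) (hy : Commute a y) {h : Aˣ} (hh : h ∈ Subgroup.closure {x, y}) :
    Commute a h := by
  induction hh using Subgroup.closure_induction with
  | mem w hw => obtain rfl | rfl := hw <;> assumption
  | one => exact Commute.one_right a
  | mul v w _ _ hv hw => exact hv.mul_right hw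
  | inv v _ hv => exact hv.units_inv_right

/-! ### Commutators of torsion units are central in the FC-center -/

namespace TwistedGroupAlgebra

variable {G K : Type*} [Group G] [Field K] {c : TwoCocycle G K}

theorem commute_commutatorElement_of_finite [Finite K] [Infinite G]
    {x y z : (TwistedGroupAlgebra c)ˣ} (hx : (conjugatesOf x).Finite)
    (hy : (conjugatesOf y).Finite) (hz : (conjugatesOf z).Finite)
    (ox : IsOfFinOrder x) (oy : IsOfFinOrder y) : Commute z ⁅x, y⁆ := by
  have := finite_closure_pair_of_finite_conjugatesOf hx hy ox oy
  have := finiteIndex_centralizer_of_finite_conjugatesOf hx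
  have := finiteIndex_centralizer_of_finite_conjugatesOf hy
  set H := Subgroup.closure {x, y}
  have hxH : x ∈ H := Subgroup.subset_closure (by simp)
  have hyH : y ∈ H := Subgroup.subset_closure (by simp)
  let S : Submonoid (TwistedGroupAlgebra c) :=
    H.toSubmonoid.map (Units.coeHom (TwistedGroupAlgebra c))
  let B := Algebra.adjoin K (S : Set (TwistedGroupAlgebra c))
  have hHB (h : (TwistedGroupAlgebra c)ˣ) (hh : h ∈ H) : (h : TwistedGroupAlgebra c) ∈ B :=
    Algebra.subset_adjoin ⟨h, hh, rfl⟩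
  have hS : (S : Set (TwistedGroupAlgebra c)).Finite := (Set.toFinite (H : Set (TwistedGroupAlgebra c)ˣ)).image _
  have hBfg : Module.Finite K B := by
    refine (Module.Finite.iff_fg (N := Subalgebra.toSubmodule B)).2 ?_
    rw [Algebra.adjoin_eq_span, Submonoid.closure_eq]
    exact Submodule.fg_span hS
  have hBfin : Finite B := Module.finite_of_finite K
  have hcomm {a b : TwistedGroupAlgebra c} (hax : Commute a x) (hay : Commute a y)
      (hb : b ∈ B) : Commute a b := by
    induction hb using Algebra.adjoin_induction with
    | mem w hw =>
      obtain ⟨h, hh, rfl⟩ := hw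
      exact commute_of_mem_closure_pair hax hay hh
    | algebraMap r => exact (Algebra.commutes r a).symm
    | add v w _ _ hv hw => exact hv.add_right hw
    | mul v w _ _ hv hw => exact hv.mul_right hw
  -- Units centralizing `x` and `y` form a subgroup of finite index and centralize all of `B`.
  have hnil {b : TwistedGroupAlgebra c} (hbB : b ∈ B) (hb : IsNilpotent b)
      {v : (TwistedGroupAlgebra c)ˣ} (hv : (conjugatesOf v).Finite) :
      Commute (v : TwistedGroupAlgebra c) b := by
    refine commute_of_isNilpotent hb (Subgroup.centralizer {x} ⊓ Subgroup.centralizer {y}) ?_ hv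
    intro w hw
    exact hcomm (congrArg Units.val (Subgroup.mem_centralizer_singleton_iff.1 hw.1))
      (congrArg Units.val (Subgroup.mem_centralizer_singleton_iff.1 hw.2)) hbB
  have hcen {a b : TwistedGroupAlgebra c} (ha : a ∈ B) (hb : b ∈ B) (hn : IsNilpotent a) :
      Commute a b := hcomm (hnil ha hn hx).symm (hnil ha hn hy).symm hb
  obtain ⟨k, hk⟩ := isNilpotent_commutator_of_finite_of_nilpotent_central (R := B)
    (fun b hb a => Subtype.ext (hcen b.2 a.2 (hb.map B.val)).eq) ⟨x, hHB x hxH⟩ ⟨y, hHB y hyH⟩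
  have hm : IsNilpotent ((x : TwistedGroupAlgebra c) * y - y * x) := ⟨k, congrArg Subtype.val hk⟩
  have hmB : (x : TwistedGroupAlgebra c) * y - y * x ∈ B :=
    B.sub_mem (B.mul_mem (hHB x hxH) (hHB y hyH)) (B.mul_mem (hHB y hyH) (hHB x hxH))
  have hvB := hHB (x⁻¹ * y⁻¹) (H.mul_mem (H.inv_mem hxH) (H.inv_mem hyH))
  have hr := hnil (B.mul_mem hmB hvB) ((hcen hmB hvB hm).isNilpotent_mul_right hm) hz
  -- `⁅x, y⁆ - 1 = (xy - yx) x⁻¹ y⁻¹` is nilpotent because `xy - yx` is nilpotent and central in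
  -- `B`.
  have he : ((x : TwistedGroupAlgebra c) * y - y * x) * ↑(x⁻¹ * y⁻¹) + 1 =
      (⁅x, y⁆ : (TwistedGroupAlgebra c)ˣ) := by
    rw [sub_mul, ← Units.val_mul, ← Units.val_mul, ← Units.val_mul, ← Units.val_mul,
      show y * x * (x⁻¹ * y⁻¹) = 1 by group, Units.val_one, sub_add_cancel, commutatorElement_def,
      mul_assoc (x * y)]
  refine Units.ext ?_
  rw [Units.val_mul, Units.val_mul, ← he]
  exact (hr.add_right (Commute.one_right _)).eq

/-- In the unit group of an infinite twisted group algebra, commutators of elements of finite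
order of the `FC`-center commute with the whole `FC`-center. -/
theorem commute_commutatorElement [Infinite (TwistedGroupAlgebra c)]
    {x y z : (TwistedGroupAlgebra c)ˣ} (hx : (conjugatesOf x).Finite)
    (hy : (conjugatesOf y).Finite) (hz : (conjugatesOf z).Finite)
    (ox : IsOfFinOrder x) (oy : IsOfFinOrder y) : Commute z ⁅x, y⁆ := by
  cases finite_or_infinite K with
  | inr h =>
    rw [commutatorElement_eq_one_iff_commute.2
      (commute_of_isOfFinOrder_of_infinite (K := K) oy hx)]
    exact Commute.one_right z
  | inl h =>
    cases finite_or_infinite G with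
    | inr h' => exact commute_commutatorElement_of_finite hx hy hz ox oy
    | inl h' =>
      -- With `K` and `G` both finite the algebra would be finite.
      exact absurd (Finite.of_injective (fun f : G →₀ K => (f : G → K)) DFunLike.coe_injective)
        (not_finite_iff_infinite.2 ‹Infinite (TwistedGroupAlgebra c)›)

end TwistedGroupAlgebra

/-! ### Derived length and nilpotency class -/

/-- If `t` contains all commutators and commutators of elements of `t` are central, the group has
derived length at most `3`. -/
theorem derivedSeries_three_eq_bot {Γ : Type*} [Group Γ] {t : Subgroup Γ}
    (ht : ∀ x y : Γ, ⁅x, y⁆ ∈ t) (hc : ∀ x ∈ t, ∀ y ∈ t, ⁅x, y⁆ ∈ Subgroup.center Γ) :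
    derivedSeries Γ 3 = ⊥ := by
  have h1 : derivedSeries Γ 1 ≤ t := by
    rw [derivedSeries_succ]
    exact Subgroup.commutator_le.2 fun x _ y _ => ht x y
  have h2 : derivedSeries Γ 2 ≤ Subgroup.center Γ := by
    rw [derivedSeries_succ]
    exact Subgroup.commutator_le.2 fun x hx y hy => hc x (h1 hx) y (h1 hy)
  rw [derivedSeries_succ, eq_bot_iff]
  refine Subgroup.commutator_le.2 fun x hx y _ => ?_
  rw [Subgroup.mem_bot, commutatorElement_eq_one_iff_mul_comm]
  exact (Subgroup.mem_center_iff.1 (h2 hx) y).symm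

theorem lowerCentralSeries_two_eq_bot {Γ : Type*} [Group Γ]
    (hc : ∀ x y : Γ, ⁅x, y⁆ ∈ Subgroup.center Γ) :
    (⊤ : Subgroup Γ).lowerCentralSeries 2 = ⊥ := by
  have h1 : (⊤ : Subgroup Γ).lowerCentralSeries 1 ≤ Subgroup.center Γ := by
    rw [Subgroup.lowerCentralSeries_succ]
    exact Subgroup.commutator_le.2 fun x _ y _ => hc x y
  rw [Subgroup.lowerCentralSeries_succ, eq_bot_iff]
  refine Subgroup.commutator_le.2 fun x hx y _ => ?_
  rw [Subgroup.mem_bot, commutatorElement_eq_one_iff_mul_comm]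
  exact (Subgroup.mem_center_iff.1 (h1 hx) y).symm

theorem mainTheorem3 {G K : Type*} [Group G] [Field K] (c : TwoCocycle G K)
    (hinf : Infinite (TwistedGroupAlgebra c)) :
    (Group.IsSolvable (fcCenter (TwistedGroupAlgebra c)ˣ) ∧
      derivedSeries (fcCenter (TwistedGroupAlgebra c)ˣ) 3 = ⊥) ∧
    (Group.IsNilpotent (fcTorsion (TwistedGroupAlgebra c)ˣ) ∧
      Group.nilpotencyClass (fcTorsion (TwistedGroupAlgebra c)ˣ) ≤ 2) := by
  have key : ∀ x ∈ fcTorsion (TwistedGroupAlgebra c)ˣ, ∀ y ∈ fcTorsion (TwistedGroupAlgebra c)ˣ,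
      ⁅x, y⁆ ∈ Subgroup.center (fcCenter (TwistedGroupAlgebra c)ˣ) := fun x hx y hy =>
    Subgroup.mem_center_iff.2 fun z => Subtype.ext
      (TwistedGroupAlgebra.commute_commutatorElement x.2 y.2 z.2
        (mem_fcTorsion_iff.1 hx) (mem_fcTorsion_iff.1 hy)).eq
  have h3 := derivedSeries_three_eq_bot (t := fcTorsion (TwistedGroupAlgebra c)ˣ)
    (fun x y => mem_fcTorsion_iff.2
      (isOfFinOrder_commutatorElement_of_finite_conjugatesOf x.2 y.2)) key
  have hl := lowerCentralSeries_two_eq_bot (Γ := fcTorsion (TwistedGroupAlgebra c)ˣ) fun x y =>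
    Subgroup.mem_center_iff.2 fun z =>
      Subtype.ext (Subgroup.mem_center_iff.1 (key x x.2 y y.2) z)
  have hn : Group.IsNilpotent (fcTorsion (TwistedGroupAlgebra c)ˣ) :=
    Subgroup.nilpotent_iff_lowerCentralSeries.2 ⟨2, hl⟩
  exact ⟨⟨⟨3, h3⟩, h3⟩, hn, Subgroup.lowerCentralSeries_eq_bot_iff_nilpotencyClass_le.1 hl⟩
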